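/- Let $0<q<1$ and write $(x;q)_n=\prod_{k=0}^{n-1}(1-xq^k)$, $(x;q)_\infty=\prod_{k=0}^{\infty}(1-xq^k)$, $(x_1,\dots,x_m;q)_n=(x_1;q)_n\cdots(x_m;q)_n$ (also for $n=\infty$), and $${}_3\phi_2\left({x_1,x_2,x_3\atop y_1,y_2};q,z\right)=\sum_{k=0}^\infty\frac{(x_1,x_2,x_3;q)_k\,z^k}{(q,y_1,y_2;q)_k}.$$ Let $a,b,c,d,r$ be complex numbers with $\max\{|a|,|b|,|c|,|d|,|r|\}<1$, put $\alpha=a^2bcdr/q$, and let $\lambda$ be a complex number. Assume that no denominator below vanishes, that is, $\alpha\ne1$, $\lambda\ne0$, and $\lambda q^k\neq 1$ for all integers $k\ge0$. Let $\sqrt{\lambda}$ and $\sqrt{q\alpha}$ be arbitrary square roots of $\lambda$ and $q\alpha$. Then all the series below converge absolutely, and $$\begin{aligned} &\sum_{n=0}^\infty \frac{(\sqrt{\lambda},-\sqrt{\lambda},ab,ac,ad,ar;q)_n\,(bcdr)^n}{(q,\sqrt{q\alpha},-\sqrt{q\alpha},\lambda,abcd,abcr;q)_n}\; {}_3\phi_2\left({abq^n,\,acq^n,\,bc\atop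 abcdq^n,\,abcrq^n};q,dr\right)\\ &\quad=\frac{(abdr,acdr;q)_\infty}{(dr,q\alpha;q)_\infty} \sum_{n=0}^\infty\frac{(1-\alpha q^{4n})\,(\alpha,ab,ac,ad,ar;q)_{2n}\,(q,q\alpha/\lambda;q^2)_n}{(1-\alpha)\,(q,abcd,abcr,abdr,acdr;q)_{2n}\,(q\alpha,q\lambda;q^2)_n}\,(bcdr)^{2n}\lambda^n q^{2n^2-n}. \end{aligned}$$ -/

import Mathlib

/-- The finite `q`-shifted factorial `(a; q)_n = ∏_{k=0}^{n-1} (1 - a q^k)`. -/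
noncomputable def qPoch (a q : ℂ) (n : ℕ) : ℂ :=
  ∏ k ∈ Finset.range n, (1 - a * q ^ k)

/-- The infinite `q`-shifted factorial `(a; q)_∞ = ∏_{k=0}^∞ (1 - a q^k)`. -/
noncomputable def qPochInf (a q : ℂ) : ℂ :=
  ∏' k : ℕ, (1 - a * q ^ k)

/-- The multiple `q`-shifted factorial `(a₁, …, a_m; q)_n`. -/
noncomputable def qPochs (as : List ℂ) (q : ℂ) (n : ℕ) : ℂ :=
  (as.map fun a => qPoch a q n).prod

/-- The multiple infinite `q`-shifted factorial `(a₁, …, a_m; q)_∞`. -/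
noncomputable def qPochsInf (as : List ℂ) (q : ℂ) : ℂ :=
  (as.map fun a => qPochInf a q).prod

/-- The `n`-th term `(a₁, …, a_{r+1}; q)_n zⁿ / (q, b₁, …, b_r; q)_n`
of a basic hypergeometric series. -/
noncomputable def qHypTerm (as bs : List ℂ) (q z : ℂ) (n : ℕ) : ℂ :=
  qPochs as q n * z ^ n / qPochs (q :: bs) q n

/-- The basic hypergeometric series `_{r+1}φ_r(a₁, …, a_{r+1}; b₁, …, b_r; q, z)`
(`as` has `r + 1` entries and `bs` has `r` entries). -/
noncomputable def qHyp (as bs : List ℂ) (q z : ℂ) : ℂ :=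
  ∑' n : ℕ, qHypTerm as bs q z n

/-- For `|q| < 1` the infinite product defining `(a; q)_∞` converges, so that `qPochInf a q`
is its actual value. -/
theorem multipliable_qPochInf {q : ℂ} (hq : ‖q‖ < 1) (a : ℂ) :
    Multipliable fun k : ℕ => 1 - a * q ^ k := by
  have h : Summable fun k : ℕ => ‖-(a * q ^ k)‖ := by
    simp only [norm_neg, norm_mul, norm_pow]
    exact (summable_geometric_of_lt_one (norm_nonneg q) hq).mul_left _
  simpa [sub_eq_add_neg] using multipliable_one_add_of_summable h

open Finset Filter Topology

theorem qPoch_zero (x q : ℂ) : qPoch x q 0 = 1 := by simp [qPoch]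

theorem qPoch_succ (x q : ℂ) (n : ℕ) : qPoch x q (n + 1) = qPoch x q n * (1 - x * q ^ n) := by
  simp [qPoch, prod_range_succ]

theorem qPoch_add (x q : ℂ) (m n : ℕ) :
    qPoch x q (m + n) = qPoch x q m * qPoch (x * q ^ m) q n := by
  simp only [qPoch, prod_range_add, pow_add, mul_assoc]

theorem qPoch_ne_zero {x q : ℂ} (h : ∀ k : ℕ, x * q ^ k ≠ 1) (n : ℕ) : qPoch x q n ≠ 0 :=
  prod_ne_zero_iff.2 fun k _ => sub_ne_zero.2 (h k).symm

theorem qPoch_mul_neg (x q : ℂ) (n : ℕ) :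
    qPoch x q n * qPoch (-x) q n = qPoch (x ^ 2) (q ^ 2) n := by
  simp only [qPoch, ← prod_mul_distrib]
  exact prod_congr rfl fun k _ => by rw [← pow_mul, mul_comm 2 k, pow_mul]; ring

/-- The `q`-Pfaff–Saalschütz sum, written without negative powers of `q`. -/
theorem qSaalschuetz {q A B C : ℂ} (hq0 : q ≠ 0) (hq : ∀ k : ℕ, q * q ^ k ≠ 1)
    (hABC : ∀ k : ℕ, A * B * C * q ^ k ≠ 1) (s : ℕ) :
    ∑ p ∈ antidiagonal s, qPoch A q p.1 * qPoch B q p.1 * qPoch C q p.2 * C ^ p.1 /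
        (qPoch q q p.1 * qPoch q q p.2 * qPoch (A * B * C) q p.1) =
      qPoch (A * C) q s * qPoch (B * C) q s / (qPoch q q s * qPoch (A * B * C) q s) := by
  rw [Nat.sum_antidiagonal_eq_sum_range_succ_mk]
  induction s with
  | zero => simp [qPoch_zero]
  | succ s ih =>
    set u : ℕ → ℕ → ℂ := fun s i => qPoch A q i * qPoch B q i * qPoch C q (s - i) * C ^ i /
        (qPoch q q i * qPoch q q (s - i) * qPoch (A * B * C) q i) with hu
    set G : ℕ → ℂ := fun i =>
      -(q ^ (s + 1) / q ^ i) * (1 - q ^ i) * (1 - A * B * C * q ^ i / q) * u (s + 1) i with hG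
    have key : ∀ i ∈ range (s + 1),
        (1 - q * q ^ s) * (1 - A * B * C * q ^ s) * u (s + 1) i
          - (1 - A * C * q ^ s) * (1 - B * C * q ^ s) * u s i = G (i + 1) - G i := by
      intro i hi
      obtain ⟨j, rfl⟩ := Nat.exists_eq_add_of_le (mem_range_succ_iff.1 hi)
      have e1 : i + j + 1 - i = j + 1 := by omega
      have e2 : i + j - i = j := by omega
      have e3 : i + j + 1 - (i + 1) = j := by omega
      simp only [hG, hu, e1, e2, e3, qPoch_succ]
      have n1 := qPoch_ne_zero hq i
      have n2 := qPoch_ne_zero hq j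
      have n3 := qPoch_ne_zero hABC i
      have n4 : 1 - q * q ^ i ≠ 0 := sub_ne_zero.2 (hq i).symm
      have n5 : 1 - q * q ^ j ≠ 0 := sub_ne_zero.2 (hq j).symm
      have n6 : 1 - A * B * C * q ^ i ≠ 0 := sub_ne_zero.2 (hABC i).symm
      have n7 : q ^ i ≠ 0 := pow_ne_zero _ hq0
      rw [pow_succ q i, pow_succ C i, pow_succ q (i + j), pow_add q i j]
      generalize q ^ i = x at *
      generalize q ^ j = t at *
      generalize h4 : 1 - q * x = d4 at *
      generalize h5 : 1 - q * t = d5 at *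
      generalize h6 : 1 - A * B * C * x = d6 at *
      clear ih
      field_simp
      rw [← h4, ← h5, ← h6]
      ring
    have hsum := sum_range_sub G (s + 1)
    rw [← sum_congr rfl key, sum_sub_distrib, ← mul_sum, ← mul_sum, ih] at hsum
    have hG0 : G 0 = 0 := by simp [hG]
    have hG1 : G (s + 1) =
        -((1 - q * q ^ s) * (1 - A * B * C * q ^ s) * u (s + 1) (s + 1)) := by
      have : q ^ (s + 1) ≠ 0 := pow_ne_zero _ hq0
      simp only [hG, div_self this]
      rw [pow_succ]
      field_simp
    rw [hG0, hG1] at hsum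
    rw [sum_range_succ]
    have n1 := qPoch_ne_zero hq s
    have n3 := qPoch_ne_zero hABC s
    have n4 : 1 - q * q ^ s ≠ 0 := sub_ne_zero.2 (hq s).symm
    have n6 : 1 - A * B * C * q ^ s ≠ 0 := sub_ne_zero.2 (hABC s).symm
    have : (1 - q * q ^ s) * (1 - A * B * C * q ^ s) *
        (∑ i ∈ range (s + 1), u (s + 1) i + u (s + 1) (s + 1)) =
        (1 - A * C * q ^ s) * (1 - B * C * q ^ s) *
        (qPoch (A * C) q s * qPoch (B * C) q s / (qPoch q q s * qPoch (A * B * C) q s)) := by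
      linear_combination hsum
    refine mul_left_cancel₀ (mul_ne_zero n4 n6) (this.trans ?_)
    simp only [qPoch_succ]
    generalize 1 - q * q ^ s = d4 at *
    generalize 1 - A * B * C * q ^ s = d6 at *
    field_simp

/-- `1 / (q; q)_{N - m}`, with the usual convention that it vanishes for `m > N`. -/
noncomputable def qInvFact (q : ℂ) (N m : ℕ) : ℂ :=
  if m ≤ N then (qPoch q q (N - m))⁻¹ else 0

theorem qInvFact_add (q : ℂ) (m j : ℕ) : qInvFact q (m + j) m = (qPoch q q j)⁻¹ := by
  simp [qInvFact]

theorem qInvFact_of_lt {q : ℂ} {N m : ℕ} (h : N < m) : qInvFact q N m = 0 := by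
  simp [qInvFact, h]

theorem qInvFact_pred {q : ℂ} (hq0 : q ≠ 0) (hq : ∀ k : ℕ, q * q ^ k ≠ 1) (N m : ℕ) :
    qInvFact q N m = (1 - q * q ^ N / q ^ m) * qInvFact q (N + 1) m := by
  have n7 : q ^ m ≠ 0 := pow_ne_zero _ hq0
  rcases le_or_gt m N with h | h
  · obtain ⟨j, rfl⟩ := Nat.exists_eq_add_of_le h
    have n5 : 1 - q * q ^ j ≠ 0 := sub_ne_zero.2 (hq j).symm
    have n2 := qPoch_ne_zero hq j
    rw [qInvFact_add, add_assoc, qInvFact_add, qPoch_succ, pow_add]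
    field_simp
  · rw [qInvFact_of_lt h]
    rcases Nat.lt_or_ge (N + 1) m with h' | h'
    · rw [qInvFact_of_lt h', mul_zero]
    · obtain rfl : m = N + 1 := by omega
      rw [← pow_succ', div_self n7, sub_self, zero_mul]

theorem qInvFact_succ {q : ℂ} (hq0 : q ≠ 0) (hq : ∀ k : ℕ, q * q ^ k ≠ 1) (N m : ℕ) :
    qInvFact q N (m + 1) = (1 - q ^ N / q ^ m) * qInvFact q N m := by
  have n7 : q ^ m ≠ 0 := pow_ne_zero _ hq0
  have h := qInvFact_pred hq0 hq N (m + 1)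
  have h' : qInvFact q (N + 1) (m + 1) = qInvFact q N m := by simp [qInvFact]
  rw [h, h', pow_succ]
  field_simp

/-- The coefficients with even index of the Bailey pair relative to `α` whose other half is
`(λ; q²)_N / ((q; q)_N (qα; q²)_N (λ; q)_N)`. -/
noncomputable def baileyCoeff (α lam q : ℂ) (n : ℕ) : ℂ :=
  (1 - α * q ^ (4 * n)) * qPoch α q (2 * n) *
      (qPoch q (q ^ 2) n * qPoch (q * α / lam) (q ^ 2) n) /
    ((1 - α) * qPoch q q (2 * n) * (qPoch (q * α) (q ^ 2) n * qPoch (q * lam) (q ^ 2) n)) *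
    lam ^ n * q ^ (2 * n ^ 2 - n)

theorem two_mul_sq_sub_succ (n : ℕ) :
    2 * (n + 1) ^ 2 - (n + 1) = 2 * n ^ 2 - n + (4 * n + 1) := by
  have : n ≤ 2 * n ^ 2 := by nlinarith [Nat.zero_le n]
  have : 2 * (n + 1) ^ 2 = 2 * n ^ 2 + 4 * n + 2 := by ring
  omega

theorem baileyCoeff_succ {α lam q : ℂ} (hq : ∀ k : ℕ, q * q ^ k ≠ 1)
    (hα : ∀ k : ℕ, α * q ^ k ≠ 1) (hlam0 : lam ≠ 0) (hlam : ∀ k : ℕ, lam * q ^ k ≠ 1) (n : ℕ) :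
    baileyCoeff α lam q (n + 1) = baileyCoeff α lam q n *
      ((1 - α * (q ^ (2 * n)) ^ 2 * q ^ 4) * (1 - α * q ^ (2 * n)) *
        (lam - α * q ^ (2 * n) * q) * q * (q ^ (2 * n)) ^ 2) /
      ((1 - α * (q ^ (2 * n)) ^ 2) * (1 - q ^ (2 * n) * q ^ 2) * (1 - lam * q ^ (2 * n) * q)) := by
  have hqα : ∀ k : ℕ, q * α * (q ^ 2) ^ k ≠ 1 := fun k h => hα (2 * k + 1) (by
    rw [← h, pow_succ, pow_mul]; ring)
  have hql : ∀ k : ℕ, q * lam * (q ^ 2) ^ k ≠ 1 := fun k h => hlam (2 * k + 1) (by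
    rw [← h, pow_succ, pow_mul]; ring)
  have n1 := qPoch_ne_zero hq (2 * n)
  have n2 := qPoch_ne_zero hqα n
  have n3 := qPoch_ne_zero hql n
  have n4 : 1 - α ≠ 0 := sub_ne_zero.2 (by simpa using (hα 0).symm)
  have n5 := sub_ne_zero.2 (hα (4 * n)).symm
  have n6 := sub_ne_zero.2 (hq (2 * n)).symm
  have n7 := sub_ne_zero.2 (hq (2 * n + 1)).symm
  have n8 := sub_ne_zero.2 (hqα n).symm
  have n9 := sub_ne_zero.2 (hql n).symm
  have h5 : 1 - α * q ^ (4 * n) = 1 - α * (q ^ (2 * n)) ^ 2 := by ring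
  have h6 : 1 - q * q ^ (2 * n) = 1 - q ^ (2 * n) * q := by ring
  have h7 : 1 - q * q ^ (2 * n + 1) = 1 - q ^ (2 * n) * q ^ 2 := by ring
  have h8 : 1 - q * α * (q ^ 2) ^ n = 1 - α * q ^ (2 * n) * q := by ring
  have h9 : 1 - q * lam * (q ^ 2) ^ n = 1 - lam * q ^ (2 * n) * q := by ring
  have h10 : 1 - α * q ^ (2 * n + 1) = 1 - α * q ^ (2 * n) * q := by ring
  have h11 : 1 - α * q ^ (4 * (n + 1)) = 1 - α * (q ^ (2 * n)) ^ 2 * q ^ 4 := by ring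
  have h12 : 1 - q * α / lam * (q ^ 2) ^ n = (lam - α * q ^ (2 * n) * q) / lam := by
    field_simp
    ring
  have h13 : 1 - q * (q ^ 2) ^ n = 1 - q ^ (2 * n) * q := by ring
  have h14 : q ^ (2 * n ^ 2 - n + (4 * n + 1)) = q ^ (2 * n ^ 2 - n) * (q * (q ^ (2 * n)) ^ 2) := by
    ring
  rw [h5] at n5
  rw [h6] at n6
  rw [h7] at n7
  rw [h8] at n8
  rw [h9] at n9
  unfold baileyCoeff
  rw [two_mul_sq_sub_succ, h14, h11, h5, mul_add 2 n 1, mul_one]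
  simp only [qPoch_succ]
  rw [h6, h7, h8, h9, h10, h12, h13]
  generalize q ^ (2 * n) = x at *
  generalize 1 - α * x ^ 2 = d5 at *
  generalize 1 - x * q = d6 at *
  generalize 1 - x * q ^ 2 = d7 at *
  generalize 1 - α * x * q = d8 at *
  generalize 1 - lam * x * q = d9 at *
  generalize 1 - α = d4 at *
  field_simp
  ring

/-- A quadratic case of the terminating very-well-poised `₆φ₅` sum, as a Bailey pair. -/
theorem sum_baileyCoeff {α lam q : ℂ} (hq0 : q ≠ 0) (hq : ∀ k : ℕ, q * q ^ k ≠ 1)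
    (hα : ∀ k : ℕ, α * q ^ k ≠ 1) (hlam0 : lam ≠ 0) (hlam : ∀ k : ℕ, lam * q ^ k ≠ 1)
    (N K : ℕ) (hK : N < 2 * K) :
    ∑ n ∈ range K, baileyCoeff α lam q n * qInvFact q N (2 * n) / qPoch (q * α) q (N + 2 * n) =
      qPoch lam (q ^ 2) N / (qPoch q q N * qPoch (q * α) (q ^ 2) N * qPoch lam q N) := by
  have hqα : ∀ k : ℕ, q * α * (q ^ 2) ^ k ≠ 1 := fun k h => hα (2 * k + 1) (by
    rw [← h, pow_succ, pow_mul]; ring)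
  have hqα' : ∀ k : ℕ, q * α * q ^ k ≠ 1 := fun k h => hα (k + 1) (by
    rw [← h, pow_succ]; ring)
  induction N with
  | zero =>
    rw [sum_eq_single 0]
    · have n4 : 1 - α ≠ 0 := sub_ne_zero.2 (by simpa using (hα 0).symm)
      simp [baileyCoeff, qInvFact, qPoch_zero, n4]
    · intro n _ hn
      rw [qInvFact_of_lt (by omega), mul_zero, zero_div]
    · intro h
      exact absurd (mem_range.2 (by omega)) h
  | succ N ih =>
    have ih := ih (by omega)
    set u : ℕ → ℕ → ℂ := fun N n =>
      baileyCoeff α lam q n * qInvFact q N (2 * n) / qPoch (q * α) q (N + 2 * n) with hu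
    set G : ℕ → ℂ := fun n =>
      -(q * q ^ N / q ^ (2 * n)) * (1 - q ^ (2 * n)) * (1 - lam * q ^ (2 * n) / q) *
        (1 - α * q ^ N * q ^ (2 * n)) * (1 - α * q ^ N * q ^ (2 * n) * q) /
        (1 - α * (q ^ (2 * n)) ^ 2) * u (N + 1) n with hG
    have key : ∀ n ∈ range K,
        (1 - q * q ^ N) * (1 - q * α * (q ^ N) ^ 2) * (1 - lam * q ^ N) * u (N + 1) n
          - (1 - lam * (q ^ N) ^ 2) * u N n = G (n + 1) - G n := by
      intro n _
      have f1 := qInvFact_pred hq0 hq N (2 * n)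
      have f2 := qInvFact_succ hq0 hq (N + 1) (2 * n + 1)
      rw [qInvFact_succ hq0 hq (N + 1) (2 * n)] at f2
      have n1 := qPoch_ne_zero hqα' (N + 2 * n)
      have n2 := sub_ne_zero.2 (hqα' (N + 2 * n)).symm
      have n3 := sub_ne_zero.2 (hqα' (N + 2 * n + 1)).symm
      have n4 := sub_ne_zero.2 (hqα' (N + 2 * n + 2)).symm
      have n5 := sub_ne_zero.2 (hα (4 * n)).symm
      have n6 := sub_ne_zero.2 (hα (4 * n + 4)).symm
      have n7 := sub_ne_zero.2 (hq (2 * n + 1)).symm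
      have n9 := sub_ne_zero.2 (hlam (2 * n + 1)).symm
      have n10 : q ^ (2 * n) ≠ 0 := pow_ne_zero _ hq0
      have e1 : N + 1 + 2 * n = N + 2 * n + 1 := by ring
      have e2 : N + 1 + (2 * n + 1 + 1) = N + 2 * n + 1 + 1 + 1 := by ring
      have h2 : 1 - q * α * q ^ (N + 2 * n) = 1 - α * q ^ N * q ^ (2 * n) * q := by ring
      have h3 : 1 - q * α * q ^ (N + 2 * n + 1) = 1 - α * q ^ N * q ^ (2 * n) * q ^ 2 := by ring
      have h4 : 1 - q * α * q ^ (N + 2 * n + 2) = 1 - α * q ^ N * q ^ (2 * n) * q ^ 3 := by ring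
      have h5 : 1 - α * q ^ (4 * n) = 1 - α * (q ^ (2 * n)) ^ 2 := by ring
      have h6 : 1 - α * q ^ (4 * n + 4) = 1 - α * (q ^ (2 * n)) ^ 2 * q ^ 4 := by ring
      have h7 : 1 - q * q ^ (2 * n + 1) = 1 - q ^ (2 * n) * q ^ 2 := by ring
      have h9 : 1 - lam * q ^ (2 * n + 1) = 1 - lam * q ^ (2 * n) * q := by ring
      have hx : q ^ (2 * n + 1 + 1) = q ^ (2 * n) * q ^ 2 := by ring
      have hx1 : q ^ (2 * n + 1) = q ^ (2 * n) * q := by ring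
      have hy1 : q ^ (N + 1) = q ^ N * q := by ring
      have h10 : 1 - α * (q ^ (2 * n) * q ^ 2) ^ 2 = 1 - α * (q ^ (2 * n)) ^ 2 * q ^ 4 := by ring
      have h11 : 1 - α * q ^ N * (q ^ (2 * n) * q ^ 2) = 1 - α * q ^ N * q ^ (2 * n) * q ^ 2 := by
        ring
      have h12 : 1 - α * q ^ N * (q ^ (2 * n) * q ^ 2) * q =
          1 - α * q ^ N * q ^ (2 * n) * q ^ 3 := by ring
      rw [h2] at n2
      rw [h3] at n3
      rw [h4] at n4
      rw [h5] at n5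
      rw [h6] at n6
      rw [h7] at n7
      rw [h9] at n9
      simp only [hG, hu]
      rw [baileyCoeff_succ hq hα hlam0 hlam, f1, show 2 * (n + 1) = 2 * n + 1 + 1 by ring, f2, e1,
        e2]
      simp only [qPoch_succ]
      rw [h2, h3, h4, hx, hx1, hy1, h10, h11, h12]
      clear f1 f2 ih hG hu h2 h3 h4 h5 h6 h7 h9 hx hx1 hy1 h10 h11 h12
      generalize q ^ (2 * n) = x at *
      generalize q ^ N = y at *
      generalize qPoch (q * α) q (N + 2 * n) = P at *
      generalize qInvFact q (N + 1) (2 * n) = R at *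
      generalize baileyCoeff α lam q n = W at *
      generalize h2 : 1 - α * y * x * q = d2 at *
      generalize h3 : 1 - α * y * x * q ^ 2 = d3 at *
      generalize h4 : 1 - α * y * x * q ^ 3 = d4 at *
      generalize h5 : 1 - α * x ^ 2 = d5 at *
      generalize h6 : 1 - α * x ^ 2 * q ^ 4 = d6 at *
      generalize h7 : 1 - x * q ^ 2 = d7 at *
      generalize h9 : 1 - lam * x * q = d9 at *
      field_simp
      rw [← h2, ← h5, ← h9]
      ring
    have hsum := sum_range_sub G K
    rw [← sum_congr rfl key, sum_sub_distrib, ← mul_sum, ← mul_sum, ih] at hsum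
    have hG0 : G 0 = 0 := by simp [hG]
    have hG1 : G K = 0 := by simp only [hG, hu, qInvFact_of_lt hK, mul_zero, zero_div]
    rw [hG0, hG1] at hsum
    have n1 := qPoch_ne_zero hq N
    have n2 := qPoch_ne_zero hqα N
    have n3 := qPoch_ne_zero hlam N
    have n4 := sub_ne_zero.2 (hq N).symm
    have n5 := sub_ne_zero.2 (hqα N).symm
    have n6 := sub_ne_zero.2 (hlam N).symm
    simp only [qPoch_succ]
    rw [← pow_mul, mul_comm 2 N, pow_mul] at n5 ⊢
    refine mul_left_cancel₀ (mul_ne_zero (mul_ne_zero n4 n5) n6)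
      ((sub_eq_zero.1 (hsum.trans (sub_self 0))).trans ?_)
    generalize 1 - q * q ^ N = d4 at *
    generalize 1 - q * α * (q ^ N) ^ 2 = d5 at *
    generalize 1 - lam * q ^ N = d6 at *
    field_simp

theorem HasSum.of_eq {ι : Type*} {f g : ι → ℂ} {s t : ℂ} (h : HasSum f s) (hg : ∀ i, g i = f i)
    (ht : t = s) : HasSum g t := by
  rwa [ht, funext hg]

theorem norm_mul_lt_one {x y : ℂ} (hx : ‖x‖ < 1) (hy : ‖y‖ < 1) : ‖x * y‖ < 1 := by
  rw [norm_mul]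
  exact mul_lt_one_of_nonneg_of_lt_one_left (norm_nonneg _) hx hy.le

theorem mul_pow_ne_one {x q : ℂ} (hq : ‖q‖ < 1) (hx : ‖x‖ < 1) (k : ℕ) : x * q ^ k ≠ 1 := by
  intro h
  have h1 : ‖x * q ^ k‖ = 1 := by rw [h, norm_one]
  rw [norm_mul, norm_pow] at h1
  have h2 : ‖q‖ ^ k ≤ 1 := pow_le_one₀ (norm_nonneg _) hq.le
  nlinarith [norm_nonneg x, norm_nonneg q]

theorem tendsto_qPoch {q : ℂ} (hq : ‖q‖ < 1) (x : ℂ) :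
    Tendsto (qPoch x q) atTop (𝓝 (qPochInf x q)) :=
  (multipliable_qPochInf hq x).hasProd.tendsto_prod_nat

theorem qPochInf_ne_zero {x q : ℂ} (hq : ‖q‖ < 1) (h : ∀ k : ℕ, x * q ^ k ≠ 1) :
    qPochInf x q ≠ 0 := by
  have hs : Summable fun k : ℕ => ‖-(x * q ^ k)‖ := by
    simp only [norm_neg, norm_mul, norm_pow]
    exact (summable_geometric_of_lt_one (norm_nonneg q) hq).mul_left _
  have := tprod_one_add_ne_zero_of_summable (f := fun k : ℕ => -(x * q ^ k))
    (fun k => by rw [← sub_eq_add_neg]; exact sub_ne_zero.2 (h k).symm) hs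
  unfold qPochInf
  simpa only [← sub_eq_add_neg] using this

theorem qPochInf_eq_qPoch_mul {q : ℂ} (hq : ‖q‖ < 1) (x : ℂ) (m : ℕ) :
    qPochInf x q = qPoch x q m * qPochInf (x * q ^ m) q := by
  refine tendsto_nhds_unique ((tendsto_qPoch hq x).comp (tendsto_add_atTop_nat m)) ?_
  refine ((tendsto_qPoch hq (x * q ^ m)).const_mul (qPoch x q m)).congr fun n => ?_
  rw [Function.comp_apply, add_comm n m, qPoch_add]

/-- A family of complex numbers that is bounded in norm. -/
def NormBounded {ι : Type*} (f : ι → ℂ) : Prop := ∃ C : ℝ, ∀ i, ‖f i‖ ≤ C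

namespace NormBounded

variable {ι κ : Type*} {f g : ι → ℂ}

theorem mul (hf : NormBounded f) (hg : NormBounded g) : NormBounded fun i => f i * g i := by
  obtain ⟨C, hC⟩ := hf
  obtain ⟨D, hD⟩ := hg
  refine ⟨C * D, fun i => ?_⟩
  rw [norm_mul]
  exact mul_le_mul (hC i) (hD i) (norm_nonneg _) ((norm_nonneg _).trans (hC i))

theorem div (hf : NormBounded f) (hg : NormBounded fun i => (g i)⁻¹) :
    NormBounded fun i => f i / g i := by
  simpa only [div_eq_mul_inv] using hf.mul hg

theorem mul_inv (hf : NormBounded fun i => (f i)⁻¹) (hg : NormBounded fun i => (g i)⁻¹) :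
    NormBounded fun i => (f i * g i)⁻¹ := by
  simpa only [_root_.mul_inv] using hf.mul hg

theorem comp (hf : NormBounded f) (e : κ → ι) : NormBounded fun i => f (e i) :=
  let ⟨C, hC⟩ := hf
  ⟨C, fun i => hC (e i)⟩

theorem const (c : ℂ) : NormBounded fun _ : ι => c := ⟨‖c‖, fun _ => le_rfl⟩

theorem of_tendsto {u : ℕ → ℂ} {l : ℂ} (h : Tendsto u atTop (𝓝 l)) : NormBounded u :=
  let ⟨C, hC⟩ := h.norm.bddAbove_range
  ⟨C, fun i => hC ⟨i, rfl⟩⟩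

theorem pow {x : ℂ} (hx : ‖x‖ ≤ 1) : NormBounded fun n : ℕ => x ^ n :=
  ⟨1, fun n => by rw [norm_pow]; exact pow_le_one₀ (norm_nonneg _) hx⟩

theorem one_sub (hf : NormBounded f) : NormBounded fun i => 1 - f i := by
  obtain ⟨C, hC⟩ := hf
  refine ⟨1 + C, fun i => (norm_sub_le _ _).trans ?_⟩
  rw [norm_one]
  linarith [hC i]

theorem summable_mul (hf : NormBounded f) (hg : Summable fun i => ‖g i‖) :
    Summable fun i => f i * g i := by
  obtain ⟨C, hC⟩ := hf
  refine Summable.of_norm_bounded (hg.mul_left C) fun i => ?_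
  rw [norm_mul]
  exact mul_le_mul_of_nonneg_right (hC i) (norm_nonneg _)

end NormBounded

theorem normBounded_qPoch {q : ℂ} (hq : ‖q‖ < 1) (x : ℂ) : NormBounded (qPoch x q) :=
  .of_tendsto (tendsto_qPoch hq x)

theorem normBounded_inv_qPoch {x q : ℂ} (hq : ‖q‖ < 1) (h : ∀ k : ℕ, x * q ^ k ≠ 1) :
    NormBounded fun n => (qPoch x q n)⁻¹ :=
  .of_tendsto ((tendsto_qPoch hq x).inv₀ (qPochInf_ne_zero hq h))

theorem summable_norm_pow {z : ℂ} (hz : ‖z‖ < 1) : Summable fun n : ℕ => ‖z ^ n‖ := by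
  simpa only [norm_pow] using summable_geometric_of_lt_one (norm_nonneg z) hz

/-- The nonterminating `q`-Gauss sum, as a limit of the `q`-Pfaff–Saalschütz sum. -/
theorem hasSum_qGauss {q A B z : ℂ} (hq0 : q ≠ 0) (hq : ‖q‖ < 1) (hz : ‖z‖ < 1)
    (hABz : ∀ k : ℕ, A * B * z * q ^ k ≠ 1) :
    HasSum (fun i => qPoch A q i * qPoch B q i * z ^ i / (qPoch q q i * qPoch (A * B * z) q i))
      (qPochInf (A * z) q * qPochInf (B * z) q / (qPochInf z q * qPochInf (A * B * z) q)) := by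
  have hqq := mul_pow_ne_one hq hq
  set t : ℕ → ℂ := fun i =>
    qPoch A q i * qPoch B q i * z ^ i / (qPoch q q i * qPoch (A * B * z) q i) with ht
  have hbt : NormBounded fun i => qPoch A q i * qPoch B q i /
      (qPoch q q i * qPoch (A * B * z) q i) :=
    ((normBounded_qPoch hq A).mul (normBounded_qPoch hq B)).div
      ((normBounded_inv_qPoch hq hqq).mul_inv (normBounded_inv_qPoch hq hABz))
  have hts : Summable t := (hbt.summable_mul (summable_norm_pow hz)).congr fun i => by
    simp only [ht]; ring
  set v : ℕ → ℂ := fun n => qPoch z q n / qPoch q q n with hv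
  have hvl : Tendsto v atTop (𝓝 (qPochInf z q / qPochInf q q)) :=
    (tendsto_qPoch hq z).div (tendsto_qPoch hq q) (qPochInf_ne_zero hq hqq)
  obtain ⟨C, hC⟩ := NormBounded.of_tendsto hvl
  have hC0 : 0 ≤ C := (norm_nonneg _).trans (hC 0)
  have hlim := tendsto_tsum_of_dominated_convergence (𝓕 := atTop)
    (f := fun s i => t i * if i ≤ s then v (s - i) else 0)
    (g := fun i => t i * (qPochInf z q / qPochInf q q)) (bound := fun i => ‖t i‖ * C)
    (hts.norm.mul_right C)
    (fun i => by
      refine Tendsto.const_mul _ ((hvl.comp (tendsto_sub_atTop_nat i)).congr' ?_)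
      filter_upwards [eventually_ge_atTop i] with s hs
      simp [hs])
    (Eventually.of_forall fun s i => by
      rw [norm_mul]
      refine mul_le_mul_of_nonneg_left ?_ (norm_nonneg _)
      split_ifs
      · exact hC _
      · simpa using hC0)
  have hfin : ∀ s, ∑' i, (t i * if i ≤ s then v (s - i) else 0) =
      qPoch (A * z) q s * qPoch (B * z) q s / (qPoch q q s * qPoch (A * B * z) q s) := by
    intro s
    rw [← qSaalschuetz hq0 hqq hABz, Nat.sum_antidiagonal_eq_sum_range_succ_mk,
      tsum_eq_sum (s := range s.succ)]
    · refine sum_congr rfl fun i hi => ?_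
      rw [if_pos (mem_range_succ_iff.1 hi)]
      simp only [ht, hv, div_mul_div_comm]
      congr 1 <;> ring
    · intro i hi
      rw [if_neg (by simpa [Nat.lt_succ_iff] using hi), mul_zero]
  simp only [hfin] at hlim
  have hlim' := ((tendsto_qPoch hq (A * z)).mul (tendsto_qPoch hq (B * z))).div
    ((tendsto_qPoch hq q).mul (tendsto_qPoch hq (A * B * z)))
    (mul_ne_zero (qPochInf_ne_zero hq hqq) (qPochInf_ne_zero hq hABz))
  have heq := tendsto_nhds_unique hlim hlim'
  rw [tsum_mul_right] at heq
  have n1 := qPochInf_ne_zero hq hqq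
  have n2 := qPochInf_ne_zero hq (mul_pow_ne_one hq hz)
  have n3 := qPochInf_ne_zero hq hABz
  have : ∑' i, t i =
      qPochInf (A * z) q * qPochInf (B * z) q / (qPochInf z q * qPochInf (A * B * z) q) := by
    generalize qPochInf (A * B * z) q = d at *
    field_simp at heq ⊢
    linear_combination heq
  exact this ▸ hts.hasSum

/-- The terms of the double series obtained by expanding the inner `₃φ₂`, without the factors
that come from the Bailey pair. -/
noncomputable def doubleTerm (q A B D R C w : ℂ) (N k : ℕ) : ℂ :=
  qPoch A q (N + k) * qPoch B q (N + k) * (qPoch D q N * qPoch R q N) * qPoch C q k /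
    (qPoch q q k * (qPoch (D * C) q (N + k) * qPoch (R * C) q (N + k))) *
    ((C * w) ^ N * w ^ k)

theorem normBounded_doubleTerm_coeff {q A B D R C : ℂ} (hq : ‖q‖ < 1)
    (hDC : ∀ k : ℕ, D * C * q ^ k ≠ 1) (hRC : ∀ k : ℕ, R * C * q ^ k ≠ 1) :
    NormBounded fun p : ℕ × ℕ =>
      qPoch A q (p.1 + p.2) * qPoch B q (p.1 + p.2) * (qPoch D q p.1 * qPoch R q p.1) *
          qPoch C q p.2 /
        (qPoch q q p.2 * (qPoch (D * C) q (p.1 + p.2) * qPoch (R * C) q (p.1 + p.2))) :=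
  NormBounded.div
    (((((normBounded_qPoch hq A).comp _).mul ((normBounded_qPoch hq B).comp _)).mul
      (((normBounded_qPoch hq D).comp _).mul ((normBounded_qPoch hq R).comp _))).mul
      ((normBounded_qPoch hq C).comp _))
    (((normBounded_inv_qPoch hq (mul_pow_ne_one hq hq)).comp _).mul_inv
      (((normBounded_inv_qPoch hq hDC).comp _).mul_inv ((normBounded_inv_qPoch hq hRC).comp _)))

theorem summable_norm_pow_mul_pow {z w : ℂ} (hz : ‖z‖ < 1) (hw : ‖w‖ < 1) :
    Summable fun p : ℕ × ℕ => ‖z ^ p.1 * w ^ p.2‖ :=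
  (summable_norm_pow hz).mul_norm (summable_norm_pow hw)

theorem hasSum_doubleTerm_div {q A B D R C w : ℂ} (hq0 : q ≠ 0) (hq : ‖q‖ < 1) (hC : ‖C‖ < 1)
    (hw : ‖w‖ < 1) (h : A * B * w = D * R * C) (hE : ∀ k : ℕ, D * R * C * q ^ k ≠ 1)
    (hDC : ∀ k : ℕ, D * C * q ^ k ≠ 1) (hRC : ∀ k : ℕ, R * C * q ^ k ≠ 1) :
    HasSum (fun p : ℕ × ℕ => doubleTerm q A B D R C w p.1 p.2 /
        (qPoch q q p.1 * qPoch (D * R * C) q p.1))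
      (qPochInf (A * w) q * qPochInf (B * w) q / (qPochInf w q * qPochInf (D * R * C) q)) := by
  have hqq := mul_pow_ne_one hq hq
  have hb : NormBounded fun p : ℕ × ℕ => (qPoch q q p.1 * qPoch (D * R * C) q p.1)⁻¹ :=
    ((normBounded_inv_qPoch hq hqq).comp _).mul_inv ((normBounded_inv_qPoch hq hE).comp _)
  have hs : Summable (fun p : ℕ × ℕ => doubleTerm q A B D R C w p.1 p.2 /
      (qPoch q q p.1 * qPoch (D * R * C) q p.1)) :=
    (((normBounded_doubleTerm_coeff (A := A) (B := B) hq hDC hRC).mul hb).summable_mul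
      (summable_norm_pow_mul_pow (norm_mul_lt_one hC hw) hw)).congr fun p => by
        simp only [doubleTerm]; ring
  have h1 := HasSum.sigma
    ((HasAntidiagonal.sigmaAntidiagonalEquivProd (A := ℕ)).hasSum_iff.2 hs.hasSum)
    (fun s => hasSum_fintype _)
  have h2 := hasSum_qGauss (A := A) (B := B) hq0 hq hw (by rwa [h])
  rw [h] at h2
  refine hs.hasSum.of_eq (fun _ => rfl) (h2.unique (h1.of_eq (fun s => ?_) rfl))
  have n1 := qPoch_ne_zero hqq s
  have n2 := qPoch_ne_zero hE s
  have n3 := qPoch_ne_zero hDC s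
  have n4 := qPoch_ne_zero hRC s
  have hS := qSaalschuetz hq0 hqq hE s
  have hc : qPoch A q s * qPoch B q s * w ^ s / (qPoch q q s * qPoch (D * R * C) q s) =
      qPoch A q s * qPoch B q s * w ^ s / (qPoch (D * C) q s * qPoch (R * C) q s) *
        (qPoch (D * C) q s * qPoch (R * C) q s / (qPoch q q s * qPoch (D * R * C) q s)) := by
    generalize qPoch (D * R * C) q s = d1 at *
    generalize qPoch (D * C) q s = d2 at *
    generalize qPoch (R * C) q s = d3 at *
    field_simp
  rw [hc, ← hS, mul_sum, ← sum_coe_sort]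
  refine sum_congr rfl fun p _ => ?_
  have hp : p.1.1 + p.1.2 = s := mem_antidiagonal.1 p.2
  simp only [Function.comp_apply, HasAntidiagonal.sigmaAntidiagonalEquivProd_apply, doubleTerm, hp]
  have hw' : w ^ s = w ^ p.1.1 * w ^ p.1.2 := by rw [← pow_add, hp]
  rw [hw', mul_pow]
  simp only [div_eq_mul_inv, mul_inv]
  ring

theorem hasSum_doubleTerm_shift {q A B D R C w : ℂ} (hq0 : q ≠ 0) (hq : ‖q‖ < 1) (hC : ‖C‖ < 1)
    (hw : ‖w‖ < 1) (h : A * B * w = D * R * C) (hE : ∀ k : ℕ, D * R * C * q ^ k ≠ 1)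
    (hDC : ∀ k : ℕ, D * C * q ^ k ≠ 1) (hRC : ∀ k : ℕ, R * C * q ^ k ≠ 1)
    (hAw : ∀ k : ℕ, A * w * q ^ k ≠ 1) (hBw : ∀ k : ℕ, B * w * q ^ k ≠ 1) (m : ℕ) :
    HasSum (fun p : ℕ × ℕ => doubleTerm q A B D R C w (m + p.1) p.2 /
        (qPoch q q p.1 * qPoch (D * R * C) q (2 * m + p.1)))
      (qPochInf (A * w) q * qPochInf (B * w) q / (qPochInf w q * qPochInf (D * R * C) q) *
        (qPoch A q m * qPoch B q m * (qPoch D q m * qPoch R q m) * (C * w) ^ m /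
          (qPoch (D * C) q m * qPoch (R * C) q m * (qPoch (A * w) q m * qPoch (B * w) q m)))) := by
  have hsh {x : ℂ} (hx : ∀ k : ℕ, x * q ^ k ≠ 1) (i k : ℕ) : x * q ^ i * q ^ k ≠ 1 := by
    rw [mul_assoc, ← pow_add]
    exact hx _
  have e1 : A * q ^ m * w = A * w * q ^ m := by ring
  have e2 : B * q ^ m * w = B * w * q ^ m := by ring
  have e3 : D * q ^ m * C = D * C * q ^ m := by ring
  have e4 : R * q ^ m * C = R * C * q ^ m := by ring
  have e5 : D * q ^ m * (R * q ^ m) * C = D * R * C * q ^ (2 * m) := by ring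
  have key := hasSum_doubleTerm_div (A := A * q ^ m) (B := B * q ^ m) (D := D * q ^ m)
    (R := R * q ^ m) hq0 hq hC hw
    (by linear_combination q ^ (2 * m) * h)
    (by rw [e5]; exact hsh hE _) (by rw [e3]; exact hsh hDC _) (by rw [e4]; exact hsh hRC _)
  rw [e1, e2, e5] at key
  have n1 := qPochInf_ne_zero hq (mul_pow_ne_one hq hw)
  have n2 := qPochInf_ne_zero hq (hsh hE (2 * m))
  have n3 := qPoch_ne_zero hE (2 * m)
  have n4 := qPoch_ne_zero hDC m
  have n5 := qPoch_ne_zero hRC m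
  have n6 := qPoch_ne_zero hAw m
  have n7 := qPoch_ne_zero hBw m
  have key' := key.mul_left (qPoch A q m * qPoch B q m * (qPoch D q m * qPoch R q m) *
    (C * w) ^ m / (qPoch (D * C) q m * qPoch (R * C) q m * qPoch (D * R * C) q (2 * m)))
  refine key'.of_eq (fun p => ?_) ?_
  · simp only [doubleTerm, e3, e4, qPoch_add _ _ m, qPoch_add _ _ (2 * m), add_assoc, pow_add]
    simp only [div_eq_mul_inv, mul_inv]
    ring
  · rw [qPochInf_eq_qPoch_mul hq (A * w) m, qPochInf_eq_qPoch_mul hq (B * w) m,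
      qPochInf_eq_qPoch_mul hq (D * R * C) (2 * m)]
    generalize qPoch (D * C) q m = d1 at *
    generalize qPoch (R * C) q m = d2 at *
    generalize qPoch (D * R * C) q (2 * m) = d3 at *
    generalize qPoch (A * w) q m = d4 at *
    generalize qPoch (B * w) q m = d5 at *
    generalize qPochInf (D * R * C * q ^ (2 * m)) q = d6 at *
    field_simp

theorem summable_qHypTerm {q x₁ x₂ x₃ y₁ y₂ z : ℂ} (hq : ‖q‖ < 1) (hz : ‖z‖ < 1)
    (h₁ : ∀ k : ℕ, y₁ * q ^ k ≠ 1) (h₂ : ∀ k : ℕ, y₂ * q ^ k ≠ 1) :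
    Summable fun k : ℕ => qHypTerm [x₁, x₂, x₃] [y₁, y₂] q z k := by
  have hb : NormBounded fun k => qPoch x₁ q k * (qPoch x₂ q k * qPoch x₃ q k) /
      (qPoch q q k * (qPoch y₁ q k * qPoch y₂ q k)) :=
    ((normBounded_qPoch hq _).mul ((normBounded_qPoch hq _).mul (normBounded_qPoch hq _))).div
      ((normBounded_inv_qPoch hq (mul_pow_ne_one hq hq)).mul_inv
        ((normBounded_inv_qPoch hq h₁).mul_inv (normBounded_inv_qPoch hq h₂)))
  refine (hb.summable_mul (summable_norm_pow hz)).congr fun k => ?_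
  simp [qHypTerm, qPochs]
  ring

theorem summable_norm_pow_mul_pow_sq {q : ℂ} (hq0 : q ≠ 0) (hq : ‖q‖ < 1) {x : ℂ} (hx : x ≠ 0) :
    Summable fun n : ℕ => ‖x ^ n * q ^ (2 * n ^ 2 - n)‖ := by
  refine Summable.norm (summable_of_ratio_test_tendsto_lt_one zero_lt_one
    (Eventually.of_forall fun n => mul_ne_zero (pow_ne_zero _ hx) (pow_ne_zero _ hq0)) ?_)
  have h4 : ‖q‖ ^ 4 < 1 := pow_lt_one₀ (norm_nonneg _) hq (by norm_num)
  have := ((tendsto_pow_atTop_nhds_zero_of_lt_one (by positivity) h4).const_mul (‖x‖ * ‖q‖))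
  rw [mul_zero] at this
  refine this.congr fun n => ?_
  have n1 : ‖x‖ ≠ 0 := norm_ne_zero_iff.2 hx
  have n2 : ‖q‖ ≠ 0 := norm_ne_zero_iff.2 hq0
  rw [two_mul_sq_sub_succ]
  simp only [norm_mul, norm_pow, pow_add, pow_mul, pow_one]
  field_simp

section

variable {q A B D R C w α lam : ℂ}

theorem summable_bailey_doubleTerm (hq0 : q ≠ 0) (hq : ‖q‖ < 1) (hC : ‖C‖ < 1)
    (hw : ‖w‖ < 1)
    (hDC : ∀ k : ℕ, D * C * q ^ k ≠ 1) (hRC : ∀ k : ℕ, R * C * q ^ k ≠ 1)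
    (hα : ∀ k : ℕ, α * q ^ k ≠ 1) (hlam0 : lam ≠ 0) (hlam : ∀ k : ℕ, lam * q ^ k ≠ 1) :
    Summable fun p : ℕ × ℕ × ℕ => baileyCoeff α lam q p.1 *
      (doubleTerm q A B D R C w (2 * p.1 + p.2.1) p.2.2 /
        (qPoch q q p.2.1 * qPoch (q * α) q (2 * (2 * p.1) + p.2.1))) := by
  have hqα : ∀ k : ℕ, q * α * (q ^ 2) ^ k ≠ 1 := fun k h => hα (2 * k + 1) (by
    rw [← h, pow_succ, pow_mul]; ring)
  have hqα' : ∀ k : ℕ, q * α * q ^ k ≠ 1 := fun k h => hα (k + 1) (by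
    rw [← h, pow_succ]; ring)
  have hql : ∀ k : ℕ, q * lam * (q ^ 2) ^ k ≠ 1 := fun k h => hlam (2 * k + 1) (by
    rw [← h, pow_succ, pow_mul]; ring)
  have hqq := mul_pow_ne_one hq hq
  have hq2 : ‖q ^ 2‖ < 1 := by rw [sq]; exact norm_mul_lt_one hq hq
  have hCw := norm_mul_lt_one hC hw
  have b1 : NormBounded fun n : ℕ => (1 - α * q ^ (4 * n)) * qPoch α q (2 * n) *
      (qPoch q (q ^ 2) n * qPoch (q * α / lam) (q ^ 2) n) /
      ((1 - α) * qPoch q q (2 * n) * (qPoch (q * α) (q ^ 2) n * qPoch (q * lam) (q ^ 2) n)) :=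
    (((((NormBounded.const α).mul ((NormBounded.pow hq.le).comp (fun n => 4 * n))).one_sub).mul
      ((normBounded_qPoch hq α).comp _)).mul
      ((normBounded_qPoch hq2 _).mul (normBounded_qPoch hq2 _))).div
    (((NormBounded.const (1 - α)⁻¹).mul_inv ((normBounded_inv_qPoch hq hqq).comp _)).mul_inv
      ((normBounded_inv_qPoch hq2 hqα).mul_inv (normBounded_inv_qPoch hq2 hql)))
  have b2 := (normBounded_doubleTerm_coeff (A := A) (B := B) hq hDC hRC).comp
    fun p : ℕ × ℕ × ℕ => (2 * p.1 + p.2.1, p.2.2)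
  have b3 : NormBounded fun p : ℕ × ℕ × ℕ =>
      (qPoch q q p.2.1 * qPoch (q * α) q (2 * (2 * p.1) + p.2.1))⁻¹ :=
    ((normBounded_inv_qPoch hq hqq).comp _).mul_inv ((normBounded_inv_qPoch hq hqα').comp _)
  have b4 := (NormBounded.pow hCw.le).comp fun p : ℕ × ℕ × ℕ => 2 * p.1
  have hs := (summable_norm_pow_mul_pow_sq hq0 hq hlam0).mul_norm
    (summable_norm_pow_mul_pow hCw hw)
  refine ((((b1.comp Prod.fst).mul b2).mul (b3.mul b4)).summable_mul hs).congr fun p => ?_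
  simp only [baileyCoeff, doubleTerm, pow_add]
  ring

theorem sum_baileyCoeff_mul_doubleTerm (hq0 : q ≠ 0) (hq : ‖q‖ < 1) (hC : ‖C‖ < 1)
    (hw : ‖w‖ < 1) (hABw : A * B * w = q * α) (hDRC : D * R * C = q * α)
    (hDC : ∀ k : ℕ, D * C * q ^ k ≠ 1) (hRC : ∀ k : ℕ, R * C * q ^ k ≠ 1)
    (hAw : ∀ k : ℕ, A * w * q ^ k ≠ 1) (hBw : ∀ k : ℕ, B * w * q ^ k ≠ 1)
    (hα : ∀ k : ℕ, α * q ^ k ≠ 1) (hlam0 : lam ≠ 0) (hlam : ∀ k : ℕ, lam * q ^ k ≠ 1)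
    (hX : ∀ N, Summable fun k => doubleTerm q A B D R C w N k) :
    ∃ S : ℂ,
      HasSum (fun N : ℕ =>
        qPoch lam (q ^ 2) N / (qPoch q q N * qPoch (q * α) (q ^ 2) N * qPoch lam q N) *
          ∑' k, doubleTerm q A B D R C w N k) S ∧
      HasSum (fun n : ℕ => baileyCoeff α lam q n *
        (qPochInf (A * w) q * qPochInf (B * w) q / (qPochInf w q * qPochInf (q * α) q) *
          (qPoch A q (2 * n) * qPoch B q (2 * n) * (qPoch D q (2 * n) * qPoch R q (2 * n)) *
              (C * w) ^ (2 * n) /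
            (qPoch (D * C) q (2 * n) * qPoch (R * C) q (2 * n) *
              (qPoch (A * w) q (2 * n) * qPoch (B * w) q (2 * n)))))) S := by
  have hqq := mul_pow_ne_one hq hq
  have hqα' : ∀ k : ℕ, q * α * q ^ k ≠ 1 := fun k h => hα (k + 1) (by
    rw [← h, pow_succ]; ring)
  have hs := summable_bailey_doubleTerm (A := A) (B := B) hq0 hq hC hw hDC hRC hα hlam0 hlam
  refine ⟨_, ?_, hs.hasSum.prod_fiberwise fun n => ?_⟩
  · set F : ℕ × ℕ × ℕ → ℂ := fun p => baileyCoeff α lam q p.1 * qInvFact q p.2.1 (2 * p.1) /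
      qPoch (q * α) q (p.2.1 + 2 * p.1) * doubleTerm q A B D R C w p.2.1 p.2.2 with hF
    set e : ℕ × ℕ × ℕ → ℕ × ℕ × ℕ := fun p => (p.1, 2 * p.1 + p.2.1, p.2.2) with he
    have hinj : Function.Injective e := by
      rintro ⟨n, j, k⟩ ⟨n', j', k'⟩ h
      simp only [he, Prod.mk.injEq] at h
      obtain ⟨rfl, h, rfl⟩ := h
      simpa using h
    have hsupp : ∀ p, p ∉ Set.range e → F p = 0 := by
      rintro ⟨n, N, k⟩ hp
      have : N < 2 * n := by
        by_contra h
        exact hp ⟨(n, N - 2 * n, k), by simp only [he, Prod.mk.injEq, true_and, and_true]; omega⟩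
      simp only [hF, qInvFact_of_lt this, mul_zero, zero_div, zero_mul]
    have h1 := (hinj.hasSum_iff hsupp).1 (hs.hasSum.of_eq (fun p => by
      simp only [hF, he, Function.comp_apply, qInvFact_add]
      rw [show 2 * p.1 + p.2.1 + 2 * p.1 = 2 * (2 * p.1) + p.2.1 by ring]
      simp only [div_eq_mul_inv, mul_inv]
      ring) rfl)
    set β : ℕ → ℂ := fun N =>
      qPoch lam (q ^ 2) N / (qPoch q q N * qPoch (q * α) (q ^ 2) N * qPoch lam q N) with hβ
    have h2 := ((Equiv.prodComm (ℕ × ℕ) ℕ).hasSum_iff.2 h1).prod_fiberwise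
      (g := fun p => β p.1 * doubleTerm q A B D R C w p.1 p.2) fun p => by
        simp only [hβ]
        rw [← sum_baileyCoeff hq0 hqq hα hlam0 hlam p.1 (p.1 + 1) (by omega), sum_mul]
        refine hasSum_sum_of_ne_finset_zero (f := fun n => F (n, p)) fun n hn => hsupp (n, p) ?_
        rintro ⟨⟨n', j, k⟩, h⟩
        have h3 : n' = n := congrArg Prod.fst h
        have h4 : 2 * n' + j = p.1 := congrArg (fun t => t.2.1) h
        rw [mem_range] at hn
        omega
    have h3 (N : ℕ) := (hX N).hasSum.mul_left (β N)
    exact h2.prod_fiberwise h3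
  · have hE : ∀ k : ℕ, D * R * C * q ^ k ≠ 1 := by rwa [hDRC]
    have h1 := hasSum_doubleTerm_shift hq0 hq hC hw (hABw.trans hDRC.symm) hE hDC hRC hAw hBw
      (2 * n)
    rw [hDRC] at h1
    have h2 := h1.mul_left (baileyCoeff α lam q n)
    exact h2

end

theorem theorem6p8 (q : ℝ) (hq0 : 0 < q) (hq1 : q < 1)
    (a b c d r : ℂ)
    (ha : ‖a‖ < 1) (hb : ‖b‖ < 1) (hc : ‖c‖ < 1) (hd : ‖d‖ < 1) (hr : ‖r‖ < 1)
    (α : ℂ) (hα : α = a ^ 2 * b * c * d * r / q)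
    -- the factor `1 - α` in a denominator does not vanish
    (hα1 : α ≠ 1)
    -- `λ`: the quotient `q α / λ` and the factors `1 / (λ; q)_n` are defined
    (lam : ℂ) (hlam0 : lam ≠ 0) (hlam : ∀ k : ℕ, lam * (q : ℂ) ^ k ≠ 1)
    -- `sl` is any square root of `λ`, and `sa` is any square root of `q α`
    (sl sa : ℂ) (hsl : sl ^ 2 = lam) (hsa : sa ^ 2 = q * α) :
    -- all the inner series converge
    (∀ n : ℕ, Summable fun k : ℕ =>
      qHypTerm [a * b * q ^ n, a * c * q ^ n, b * c]
        [a * b * c * d * q ^ n, a * b * c * r * q ^ n] q (d * r) k) ∧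
    -- the outer series on the left converges
    (Summable fun n : ℕ =>
      qPochs [sl, -sl, a * b, a * c, a * d, a * r] q n * (b * c * d * r) ^ n /
          qPochs [(q : ℂ), sa, -sa, lam, a * b * c * d, a * b * c * r] q n *
        qHyp [a * b * q ^ n, a * c * q ^ n, b * c]
          [a * b * c * d * q ^ n, a * b * c * r * q ^ n] q (d * r)) ∧
    -- the series on the right converges
    (Summable fun n : ℕ =>
      (1 - α * q ^ (4 * n)) * qPochs [α, a * b, a * c, a * d, a * r] q (2 * n) *
            qPochs [(q : ℂ), q * α / lam] ((q : ℂ) ^ 2) n /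
          ((1 - α) *
            qPochs [(q : ℂ), a * b * c * d, a * b * c * r, a * b * d * r, a * c * d * r]
              q (2 * n) *
            qPochs [q * α, q * lam] ((q : ℂ) ^ 2) n) *
        (b * c * d * r) ^ (2 * n) * lam ^ n * (q : ℂ) ^ (2 * n ^ 2 - n)) ∧
    -- the identity
    (∑' n : ℕ,
      qPochs [sl, -sl, a * b, a * c, a * d, a * r] q n * (b * c * d * r) ^ n /
          qPochs [(q : ℂ), sa, -sa, lam, a * b * c * d, a * b * c * r] q n *
        qHyp [a * b * q ^ n, a * c * q ^ n, b * c]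
          [a * b * c * d * q ^ n, a * b * c * r * q ^ n] q (d * r)) =
      qPochsInf [a * b * d * r, a * c * d * r] q / qPochsInf [d * r, q * α] q *
        ∑' n : ℕ,
          (1 - α * q ^ (4 * n)) * qPochs [α, a * b, a * c, a * d, a * r] q (2 * n) *
                qPochs [(q : ℂ), q * α / lam] ((q : ℂ) ^ 2) n /
              ((1 - α) *
                qPochs [(q : ℂ), a * b * c * d, a * b * c * r, a * b * d * r, a * c * d * r]
                  q (2 * n) *
                qPochs [q * α, q * lam] ((q : ℂ) ^ 2) n) *
            (b * c * d * r) ^ (2 * n) * lam ^ n * (q : ℂ) ^ (2 * n ^ 2 - n) := by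
  have hQ0 : (q : ℂ) ≠ 0 := Complex.ofReal_ne_zero.2 hq0.ne'
  have hQ : ‖(q : ℂ)‖ < 1 := by rwa [Complex.norm_real, Real.norm_of_nonneg hq0.le]
  generalize (q : ℂ) = Q at *
  have hab := norm_mul_lt_one ha hb
  have hbc := norm_mul_lt_one hb hc
  have hdr := norm_mul_lt_one hd hr
  have hbound {x y : ℂ} (hx : ‖x‖ < 1) (hy : ‖y‖ < 1) (k : ℕ) : x * y * Q ^ k ≠ 1 :=
    mul_pow_ne_one hQ (norm_mul_lt_one hx hy) k
  have habcd := hbound (norm_mul_lt_one hab hc) hd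
  have habcr := hbound (norm_mul_lt_one hab hc) hr
  have habdr := hbound (norm_mul_lt_one hab hd) hr
  have hacdr := hbound (norm_mul_lt_one (norm_mul_lt_one ha hc) hd) hr
  have hQα : Q * α = a ^ 2 * b * c * d * r := by rw [hα]; field_simp
  have hQα1 : ∀ k : ℕ, Q * α * Q ^ k ≠ 1 := by
    intro k
    rw [hQα, show a ^ 2 * b * c * d * r = a * b * c * d * (a * r) by ring]
    exact hbound (norm_mul_lt_one (norm_mul_lt_one hab hc) hd) (norm_mul_lt_one ha hr) k
  have hα' : ∀ k : ℕ, α * Q ^ k ≠ 1 := by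
    rintro (_ | k)
    · simpa using hα1
    · intro h
      exact hQα1 k (by rw [← h, pow_succ]; ring)
  have hshift {x : ℂ} (hx : ∀ k : ℕ, x * Q ^ k ≠ 1) (i k : ℕ) : x * Q ^ i * Q ^ k ≠ 1 := by
    rw [mul_assoc, ← pow_add]
    exact hx _
  have hinner : ∀ n : ℕ, Summable fun k : ℕ =>
      qHypTerm [a * b * Q ^ n, a * c * Q ^ n, b * c]
        [a * b * c * d * Q ^ n, a * b * c * r * Q ^ n] Q (d * r) k := fun n =>
    summable_qHypTerm hQ hdr (hshift habcd n) (hshift habcr n)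
  have e1 : a * d * (b * c) = a * b * c * d := by ring
  have e2 : a * r * (b * c) = a * b * c * r := by ring
  have e3 : a * b * (d * r) = a * b * d * r := by ring
  have e4 : a * c * (d * r) = a * c * d * r := by ring
  have e5 : b * c * (d * r) = b * c * d * r := by ring
  have hterm : ∀ N k : ℕ,
      doubleTerm Q (a * b) (a * c) (a * d) (a * r) (b * c) (d * r) N k =
        qPoch (a * b) Q N * qPoch (a * c) Q N * (qPoch (a * d) Q N * qPoch (a * r) Q N) *
            (b * c * d * r) ^ N / (qPoch (a * b * c * d) Q N * qPoch (a * b * c * r) Q N) *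
          qHypTerm [a * b * Q ^ N, a * c * Q ^ N, b * c]
            [a * b * c * d * Q ^ N, a * b * c * r * Q ^ N] Q (d * r) k := by
    intro N k
    simp only [doubleTerm, qHypTerm, qPochs, List.map_cons, List.map_nil, List.prod_cons,
      List.prod_nil, e1, e2, e5, qPoch_add _ _ N k, div_eq_mul_inv, mul_inv]
    ring
  obtain ⟨S, hL, hR⟩ := sum_baileyCoeff_mul_doubleTerm (A := a * b) (B := a * c) (D := a * d)
    (R := a * r) (C := b * c) (w := d * r) (α := α) hQ0 hQ hbc hdr
    (by rw [hQα]; ring) (by rw [hQα]; ring) (by rwa [e1]) (by rwa [e2]) (by rwa [e3]) (by rwa [e4])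
    hα' hlam0 hlam (fun N => ((hinner N).mul_left _).congr fun k => (hterm N k).symm)
  simp only [e1, e2, e3, e4, e5, hterm, tsum_mul_left] at hL hR
  have hL' : HasSum (fun n : ℕ =>
      qPochs [sl, -sl, a * b, a * c, a * d, a * r] Q n * (b * c * d * r) ^ n /
          qPochs [Q, sa, -sa, lam, a * b * c * d, a * b * c * r] Q n *
        qHyp [a * b * Q ^ n, a * c * Q ^ n, b * c]
          [a * b * c * d * Q ^ n, a * b * c * r * Q ^ n] Q (d * r)) S := by
    refine hL.of_eq (fun n => ?_) rfl
    rw [← hsl, ← hsa, ← qPoch_mul_neg, ← qPoch_mul_neg]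
    simp only [qHyp, qPochs, List.map_cons, List.map_nil, List.prod_cons, List.prod_nil,
      div_eq_mul_inv, mul_inv]
    ring
  set P : ℂ := qPochsInf [a * b * d * r, a * c * d * r] Q / qPochsInf [d * r, Q * α] Q with hP
  have hPval : P = qPochInf (a * b * d * r) Q * qPochInf (a * c * d * r) Q /
      (qPochInf (d * r) Q * qPochInf (Q * α) Q) := by
    simp [hP, qPochsInf]
  have hP0 : P ≠ 0 := by
    rw [hPval]
    exact div_ne_zero
      (mul_ne_zero (qPochInf_ne_zero hQ habdr) (qPochInf_ne_zero hQ hacdr))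
      (mul_ne_zero (qPochInf_ne_zero hQ (mul_pow_ne_one hQ hdr)) (qPochInf_ne_zero hQ hQα1))
  rw [← hPval] at hR
  have hR' : HasSum (fun n : ℕ =>
      (1 - α * Q ^ (4 * n)) * qPochs [α, a * b, a * c, a * d, a * r] Q (2 * n) *
            qPochs [Q, Q * α / lam] (Q ^ 2) n /
          ((1 - α) *
            qPochs [Q, a * b * c * d, a * b * c * r, a * b * d * r, a * c * d * r] Q (2 * n) *
            qPochs [Q * α, Q * lam] (Q ^ 2) n) *
        (b * c * d * r) ^ (2 * n) * lam ^ n * Q ^ (2 * n ^ 2 - n)) (P⁻¹ * S) := by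
    refine (hR.mul_left P⁻¹).of_eq (fun n => ?_) rfl
    rw [mul_left_comm (baileyCoeff α lam Q n), inv_mul_cancel_left₀ hP0]
    simp only [baileyCoeff, qPochs, List.map_cons, List.map_nil, List.prod_cons, List.prod_nil,
      div_eq_mul_inv, mul_inv]
    ring
  refine ⟨hinner, hL'.summable, hR'.summable, ?_⟩
  rw [hL'.tsum_eq, hR'.tsum_eq, mul_inv_cancel_left₀ hP0]
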